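/- Let $(R,\mathfrak m)$ be a (Noetherian) Cohen–Macaulay local ring of Krull dimension one which is not Gorenstein and which has a canonical module $\omega_R$. Let $\mathrm{tr}_R(\omega_R)=\sum_{f\in\mathrm{Hom}_R(\omega_R,R)}\mathrm{Im}\, f$ be the trace ideal of $\omega_R$. Let $S\subseteq R$ be a subring such that $S$ is a Gorenstein ring and the extension $S\subseteq R$ is birational, i.e. $\mathrm Q(S)=\mathrm Q(R)$, where $\mathrm Q(-)$ denotes the total ring of fractions, and $R$ is finitely generated as an $S$-module. Let $S:R=\{x\in \mathrm Q(R) : xR\subseteq S\}$. Then $S:R\subseteq \mathrm{tr}_R(\omega_R)$, the $S$-modules $R/\mathrm{tr}_R(\omega_R)$, $R/S$ and $\mathrm{tr}_R(\omega_R)/(S:R)$ have finite length, and $$\ell_S(R/\mathrm{tr}_R(\omega_R)) = 2\,\ell_S(R/S)-\ell_S\big(\mathrm{tr}_R(\omega_R)/(S:R)\big),$$ where $\ell_S(-)$ denotes the length of an $S$-module. -/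

import Mathlib

open CategoryTheory

universe u

noncomputable section

/-- A finitely generated module `M` over a Noetherian local ring `R` is maximal Cohen-Macaulay if
its depth equals `dim R`: there is an `M`-regular sequence in the maximal ideal of `R` whose length
is the Krull dimension of `R`.  (`IsRegular` includes that `M` is nonzero.) -/
def IsMaximalCohenMacaulay (R : Type u) [CommRing R] [IsLocalRing R]
    (M : Type u) [AddCommGroup M] [Module R M] : Prop :=
  Module.Finite R M ∧ ∃ rs : List R, (∀ r ∈ rs, r ∈ IsLocalRing.maximalIdeal R) ∧
    RingTheory.Sequence.IsRegular M rs ∧ ringKrullDim R = (rs.length : WithBot ℕ∞)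

/-- A Cohen-Macaulay local ring: a Noetherian local ring whose depth equals its dimension. -/
def IsCohenMacaulayLocalRing (R : Type u) [CommRing R] [IsLocalRing R] : Prop :=
  IsNoetherianRing R ∧ IsMaximalCohenMacaulay R R

/-- The injective dimension of the `R`-module `M` is finite. -/
def HasFiniteInjectiveDimension (R : Type u) [CommRing R]
    (M : Type u) [AddCommGroup M] [Module R M] : Prop :=
  ∃ n : ℕ, HasInjectiveDimensionLE (ModuleCat.of R M) n

/-- A Gorenstein ring: a Noetherian ring each of whose localizations at maximal ideals has finite
injective dimension as a module over itself. -/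
def IsGorensteinRing (A : Type u) [CommRing A] : Prop :=
  IsNoetherianRing A ∧ ∀ (P : Ideal A) [P.IsMaximal],
    HasFiniteInjectiveDimension (Localization.AtPrime P) (Localization.AtPrime P)

/-- A canonical module of a Cohen-Macaulay local ring `R` of dimension `d` with residue field `k`:
a maximal Cohen-Macaulay module of finite injective dimension and of type `1`.  The type of a
maximal Cohen-Macaulay module `ω` is `dim_k Ext^d(k, ω)`, which is the length of the `R`-module
`Ext^d(k, ω)`. -/
structure IsCanonicalModule (R : Type u) [CommRing R] [IsLocalRing R]
    (ω : Type u) [AddCommGroup ω] [Module R ω] : Prop where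
  maximalCohenMacaulay : IsMaximalCohenMacaulay R ω
  finiteInjectiveDimension : HasFiniteInjectiveDimension R ω
  type_eq_one : ∃ d : ℕ, ringKrullDim R = (d : WithBot ℕ∞) ∧
    Module.length R (Abelian.Ext (ModuleCat.of R (IsLocalRing.ResidueField R))
      (ModuleCat.of R ω) d) = 1

/-- The trace ideal `tr_R(M)`: the sum of the images of all `R`-linear maps `M → R`. -/
def traceIdeal (R : Type u) [CommRing R] (M : Type u) [AddCommGroup M] [Module R M] : Ideal R :=
  ⨆ f : M →ₗ[R] R, LinearMap.range f

/-- The extension `S ⊆ R` is birational: `Q(S) = Q(R)`, i.e. the composite `S → R → Q(R)` is a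
total ring of fractions of `S`, and `R` is finitely generated as an `S`-module. -/
def IsBirationalExtension {R : Type u} [CommRing R] (S : Subring R) : Prop :=
  IsFractionRing S (FractionRing R) ∧ Module.Finite S R

/-- The image of an ideal of `R` in `Q(R)`, as an `S`-submodule of `Q(R)`. -/
def imageInQ {R : Type u} [CommRing R] (S : Subring R) (I : Ideal R) :
    Submodule S (FractionRing R) :=
  (Submodule.map (Algebra.linearMap R (FractionRing R)) I).restrictScalars S

/-- The colon `S : R = {x ∈ Q(R) | x R ⊆ S}`, an `S`-submodule of `Q(R)`.  Here
`1 : Submodule S Q(R)` is the image of `S` in `Q(R)`. -/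
def colonSR {R : Type u} [CommRing R] (S : Subring R) : Submodule S (FractionRing R) :=
  1 / imageInQ S ⊤

end

/-! The conductor `c = S : R` is an ideal of `R`, and because `S` is Gorenstein it is a copy of
`Hom_S(R, S)`, hence of the canonical module. So `ω ≅ c ⊆ R`, which puts `c` inside the trace ideal.
Duality over `S` also gives `ℓ(R/c) = 2 ℓ(R/S)`, and additivity of length along `c ⊆ tr(ω) ⊆ R`
yields the formula.

Everything is done by hand modulo one regular element `x ∈ c ∩ 𝔪`. Duality enters only through
`IsSocleCyclic`, which bounds `ℓ(Hom(N, E))` by `ℓ(N)` (`length_hom_le`). It holds for `S/xS`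
because finite injective dimension allows maps from ideals to be lifted, and for `ω/xω` because
`Ext¹(k, ω)` has length one.

For `ω ≅ c` (`nonempty_linearEquiv_of_isSocleCyclic`), the socle of `c/xc` is shown to be cyclic, a
map `c → ω` nonzero on that socle modulo `x` is built by lifting, and it is an isomorphism modulo
`x` by comparing lengths; Nakayama finishes. For `ℓ(R/c)` (`length_quotient_conductorIdeal`), two
inequalities given by `length_hom_le` have equal sums, so both are equalities. -/

open IsLocalRing Abelian
open scoped nonZeroDivisors

/-! ### Vanishing of Ext in long exact sequences. -/

section ExtVanishing

variable {B : Type u} [CommRing B]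

lemma shortExact_of_linearMap {X Y Z : Type u} [AddCommGroup X] [AddCommGroup Y] [AddCommGroup Z]
    [Module B X] [Module B Y] [Module B Z] (f : X →ₗ[B] Y) (g : Y →ₗ[B] Z)
    (hf : Function.Injective f) (hg : Function.Surjective g) (h : Function.Exact f g) :
    (ModuleCat.shortComplexOfCompEqZero f g h.linearMap_comp_eq_zero).ShortExact where
  exact := ModuleCat.shortComplex_exact _ h
  mono_f := (ModuleCat.mono_iff_injective _).2 hf
  epi_g := (ModuleCat.epi_iff_surjective _).2 hg

variable {S : ShortComplex (ModuleCat.{u} B)} (hS : S.ShortExact) (M : ModuleCat.{u} B)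

include hS

lemma CategoryTheory.ShortComplex.ShortExact.subsingleton_ext₁ (i : ℕ)
    (h₂ : Subsingleton (Ext S.X₂ M i)) (h₃ : Subsingleton (Ext S.X₃ M (i + 1))) :
    Subsingleton (Ext S.X₁ M i) := by
  refine subsingleton_of_forall_eq 0 fun e => ?_
  obtain ⟨y, rfl⟩ := Ext.contravariant_sequence_exact₁ hS M e (Nat.add_comm 1 i)
    (Subsingleton.elim _ _)
  rw [Subsingleton.elim y 0, Ext.comp_zero]

lemma CategoryTheory.ShortComplex.ShortExact.subsingleton_ext₂ (i : ℕ)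
    (h₁ : Subsingleton (Ext S.X₁ M i)) (h₃ : Subsingleton (Ext S.X₃ M i)) :
    Subsingleton (Ext S.X₂ M i) := by
  refine subsingleton_of_forall_eq 0 fun e => ?_
  obtain ⟨y, rfl⟩ := Ext.contravariant_sequence_exact₂ hS M e (Subsingleton.elim _ _)
  rw [Subsingleton.elim y 0, Ext.comp_zero]

lemma CategoryTheory.ShortComplex.ShortExact.subsingleton_ext₃ (i : ℕ)
    (h₁ : Subsingleton (Ext S.X₁ M i)) (h₂ : Subsingleton (Ext S.X₂ M (i + 1))) :
    Subsingleton (Ext S.X₃ M (i + 1)) := by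
  refine subsingleton_of_forall_eq 0 fun e => ?_
  obtain ⟨y, rfl⟩ := Ext.contravariant_sequence_exact₃ hS M e (Subsingleton.elim _ _)
    (Nat.add_comm 1 i)
  rw [Subsingleton.elim y 0, Ext.comp_zero]

end ExtVanishing

/-! ### Existence of socle elements. -/

section Socle

variable {B : Type u} [CommRing B] [IsLocalRing B] [IsNoetherianRing B] {x : B}
  (hx : ∀ P : Ideal B, P.IsPrime → x ∈ P → P = maximalIdeal B)

include hx

/-- If the maximal ideal is the only prime containing `x`, every nonzero element killed by `x` has
a nonzero multiple in the socle. -/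
lemma exists_smul_mem_socle {M : Type*} [AddCommGroup M] [Module B M] {w : M} (hw : w ≠ 0)
    (hxw : x • w = 0) : ∃ r : B, r • w ≠ 0 ∧ ∀ t, t • (r • w) = 0 ↔ t ∈ maximalIdeal B := by
  have : Nontrivial (Submodule.span B {w}) :=
    ⟨⟨⟨w, Submodule.mem_span_singleton_self w⟩, 0, fun h => hw (congrArg Subtype.val h)⟩⟩
  -- An associated prime of the cyclic module `Bw` contains `x`, so it is the maximal ideal.
  obtain ⟨P, hP⟩ := associatedPrimes.nonempty B (Submodule.span B {w})
  rw [AssociatedPrimes.mem_iff, isAssociatedPrime_iff] at hP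
  obtain ⟨hPp, ⟨y, hy⟩, rfl⟩ := hP
  obtain ⟨r, rfl⟩ := Submodule.mem_span_singleton.1 hy
  have key : ∀ t, t • (r • w) = 0 ↔
      t ∈ Submodule.colon (⊥ : Submodule B (Submodule.span B {w})) {⟨r • w, hy⟩} := by
    intro t
    simp [Submodule.mem_colon_singleton, Subtype.ext_iff]
  have hm := hx _ hPp ((key x).1 (by rw [smul_comm, hxw, smul_zero]))
  rw [hm] at key
  refine ⟨r, fun h0 => ?_, key⟩
  have := (key 1).1 (by rw [h0, smul_zero])
  exact (Ideal.ne_top_iff_one _).1 (maximalIdeal.isMaximal B).ne_top this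

end Socle

/-! ### Finite injective dimension in dimension one: `Ext²` vanishing and lifting. -/

section ExtDevissage

variable {B : Type u} [CommRing B]

/-- The sequence `0 → B/(I : y) → B/I → B/(I + y) → 0`. -/
lemma shortExact_quotient_colon (I J : Ideal B) (y : B) (hJ : ∀ t, t ∈ J ↔ t * y ∈ I) :
    ∃ S : ShortComplex (ModuleCat.{u} B), S.ShortExact ∧ S.X₁ = ModuleCat.of B (B ⧸ J) ∧
      S.X₂ = ModuleCat.of B (B ⧸ I) ∧ S.X₃ = ModuleCat.of B (B ⧸ (I ⊔ Ideal.span {y})) := by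
  let f : (B ⧸ J) →ₗ[B] (B ⧸ I) := Submodule.mapQ J I (LinearMap.mulRight B y)
    fun t ht => (hJ t).1 ht
  let g : (B ⧸ I) →ₗ[B] (B ⧸ (I ⊔ Ideal.span {y})) := Submodule.mapQ I _ LinearMap.id le_sup_left
  have hf : ∀ a, f (Submodule.Quotient.mk a) = Submodule.Quotient.mk (a * y) := fun _ => rfl
  refine ⟨_, shortExact_of_linearMap f g ?_ ?_ ?_, rfl, rfl, rfl⟩
  · rw [injective_iff_map_eq_zero]
    intro a
    obtain ⟨a, rfl⟩ := Submodule.Quotient.mk_surjective _ a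
    intro ha
    rw [hf, Submodule.Quotient.mk_eq_zero] at ha
    exact (Submodule.Quotient.mk_eq_zero _).2 ((hJ a).2 ha)
  · intro a
    obtain ⟨a, rfl⟩ := Submodule.Quotient.mk_surjective _ a
    exact ⟨Submodule.Quotient.mk a, rfl⟩
  · intro a
    obtain ⟨a, rfl⟩ := Submodule.Quotient.mk_surjective _ a
    rw [Submodule.mapQ_apply, LinearMap.id_apply, Submodule.Quotient.mk_eq_zero,
      Submodule.mem_sup]
    constructor
    · rintro ⟨i, hi, z, hz, rfl⟩
      obtain ⟨c, rfl⟩ := Ideal.mem_span_singleton'.1 hz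
      refine ⟨Submodule.Quotient.mk c, ?_⟩
      rw [hf, Submodule.Quotient.eq]
      simpa using hi
    · rintro ⟨c, hc⟩
      obtain ⟨c, rfl⟩ := Submodule.Quotient.mk_surjective _ c
      rw [hf, eq_comm, Submodule.Quotient.eq] at hc
      exact ⟨_, hc, c * y, Ideal.mem_span_singleton'.2 ⟨c, rfl⟩, by ring⟩

lemma shortExact_ideal_quotient (I : Ideal B) :
    (ModuleCat.shortComplexOfCompEqZero I.subtype I.mkQ
      (LinearMap.exact_subtype_mkQ I).linearMap_comp_eq_zero).ShortExact :=
  shortExact_of_linearMap _ _ I.subtype_injective I.mkQ_surjective (LinearMap.exact_subtype_mkQ I)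

instance projective_of_ring : Projective (ModuleCat.of B B) :=
  ModuleCat.projective_of_free (Module.Basis.singleton Unit B)

lemma subsingleton_ext_ring (M : ModuleCat.{u} B) (i : ℕ) :
    Subsingleton (Ext (ModuleCat.of B B) M (i + 1)) :=
  subsingleton_of_forall_eq 0 fun e => Ext.eq_zero_of_projective e

/-- Multiplication by `x` gives a free resolution of length one. -/
lemma subsingleton_ext_quotient_span {x : B} (hx : ∀ t, t * x = 0 → t = 0) (M : ModuleCat.{u} B)
    (i : ℕ) : Subsingleton (Ext (ModuleCat.of B (B ⧸ Ideal.span {x})) M (i + 2)) := by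
  have hE : Function.Exact (LinearMap.mulRight B x) (Ideal.span {x}).mkQ := by
    intro a
    rw [Submodule.mkQ_apply, Submodule.Quotient.mk_eq_zero, Ideal.mem_span_singleton']
    rfl
  have hS := shortExact_of_linearMap (LinearMap.mulRight B x) (Ideal.span {x}).mkQ
    ((injective_iff_map_eq_zero _).2 fun a ha => hx a ha) (Submodule.mkQ_surjective _) hE
  exact hS.subsingleton_ext₃ M (i + 1) (subsingleton_ext_ring M i) (subsingleton_ext_ring M _)

variable [IsLocalRing B] [IsNoetherianRing B] {x : B}
  (hx : ∀ P : Ideal B, P.IsPrime → x ∈ P → P = maximalIdeal B)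

include hx

/-- `B/I` is filtered by copies of the residue field: a socle generator `y` of `B/I` gives `0 → k →
B/I → B/(I + y) → 0`, and Noetherian induction handles the larger ideal. -/
lemma subsingleton_ext_quotient_of_residue (M : ModuleCat.{u} B) (i : ℕ)
    (hk : Subsingleton (Ext (ModuleCat.of B (B ⧸ maximalIdeal B)) M i)) (I : Ideal B) :
    x ∈ I → Subsingleton (Ext (ModuleCat.of B (B ⧸ I)) M i) := by
  induction I using IsNoetherian.induction with
  | hgt I ih =>
    intro hI
    by_cases hT : I = ⊤
    · have : Subsingleton (B ⧸ I) := Ideal.Quotient.subsingleton_iff.2 hT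
      have h0 : Limits.IsZero (ModuleCat.of B (B ⧸ I)) := ModuleCat.isZero_of_subsingleton _
      refine subsingleton_of_forall_eq 0 fun e => ?_
      rw [← Ext.mk₀_id_comp e, h0.eq_of_src (𝟙 _) 0, Ext.mk₀_zero, Ext.zero_comp]
    · have : (Submodule.Quotient.mk 1 : B ⧸ I) ≠ 0 := fun h =>
        hT ((Ideal.eq_top_iff_one I).2 ((Submodule.Quotient.mk_eq_zero I).1 h))
      obtain ⟨y, hy0, hy⟩ := exists_smul_mem_socle hx this
        (by rw [← Submodule.Quotient.mk_smul, Submodule.Quotient.mk_eq_zero]; simpa)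
      simp only [← Submodule.Quotient.mk_smul, Submodule.Quotient.mk_eq_zero, smul_eq_mul,
        mul_one, ne_eq] at hy0 hy
      obtain ⟨S, hS, e1, e2, e3⟩ := shortExact_quotient_colon I (maximalIdeal B) y
        fun t => (hy t).symm
      have := hS.subsingleton_ext₂ M i (by rw [e1]; exact hk) (by
        rw [e3]
        refine ih _ (lt_of_le_of_ne le_sup_left fun h => hy0 ?_) (Ideal.mem_sup_left hI)
        rw [h]
        exact Ideal.mem_sup_right (Ideal.mem_span_singleton_self y))
      rwa [e2] at this

/-- Over a Noetherian local ring with a nonzerodivisor `x` such that the maximal ideal is the only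
prime containing `x`, a module of finite injective dimension has `Ext²(B/I, M) = 0` for every
ideal `I` containing `x`. -/
lemma subsingleton_ext_of_finite_injectiveDimension (hxr : ∀ t, t * x = 0 → t = 0)
    (hxm : x ∈ maximalIdeal B) {M : ModuleCat.{u} B} {n : ℕ} (hM : HasInjectiveDimensionLE M n)
    {I : Ideal B} (hI : x ∈ I) : Subsingleton (Ext (ModuleCat.of B (B ⧸ I)) M 2) := by
  -- Descending induction on the degree `i + 2`. For `j = 0` it exceeds `n`. In the step, `0 → k →
  -- B/x → B/(x, y) → 0` moves vanishing from degree `i + 3` down to `k` in degree `i + 2`, since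
  -- `B/x` has no Ext beyond degree one.
  have key : ∀ j i : ℕ, n ≤ i + j → ∀ I : Ideal B, x ∈ I →
      Subsingleton (Ext (ModuleCat.of B (B ⧸ I)) M (i + 2)) := by
    intro j
    induction j with
    | zero =>
      intro i hi I _
      exact HasInjectiveDimensionLT.subsingleton M (n + 1) (i + 2) (by omega) _
    | succ j ih =>
      intro i hi
      refine subsingleton_ext_quotient_of_residue hx M (i + 2) ?_
      have h1 : (Submodule.Quotient.mk 1 : B ⧸ Ideal.span {x}) ≠ 0 := fun h => by
        have := (Ideal.span_singleton_le_iff_mem _).2 hxm ((Submodule.Quotient.mk_eq_zero _).1 h)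
        exact (Ideal.ne_top_iff_one _).1 (maximalIdeal.isMaximal B).ne_top this
      obtain ⟨y, hy0, hy⟩ := exists_smul_mem_socle hx h1
        (by rw [← Submodule.Quotient.mk_smul, Submodule.Quotient.mk_eq_zero]
            simp)
      simp only [← Submodule.Quotient.mk_smul, Submodule.Quotient.mk_eq_zero, smul_eq_mul,
        mul_one, ne_eq] at hy0 hy
      obtain ⟨S, hS, e1, e2, e3⟩ := shortExact_quotient_colon (Ideal.span {x}) (maximalIdeal B) y
        fun t => (hy t).symm
      have := hS.subsingleton_ext₁ M (i + 2)
        (by rw [e2]; exact subsingleton_ext_quotient_span hxr M i) (by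
          rw [e3]
          exact ih (i + 1) (by omega) _
            (Ideal.mem_sup_left (Ideal.mem_span_singleton_self x)))
      rwa [e1] at this
  exact key n 0 (by omega) I hI

/-- A linear map `I → M/zM` with `x ∈ I` lifts to `I → M`. -/
lemma exists_lift_of_finite_injectiveDimension (hxr : ∀ t, t * x = 0 → t = 0)
    (hxm : x ∈ maximalIdeal B) {M : Type u} [AddCommGroup M] [Module B M]
    (hM : HasFiniteInjectiveDimension B M) {I : Ideal B} (hI : x ∈ I)
    {z : B} (hz : ∀ w : M, z • w = 0 → w = 0) {N : Submodule B M}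
    (hN : ∀ w, w ∈ N ↔ ∃ v, z • v = w) (f : I →ₗ[B] M ⧸ N) :
    ∃ F : I →ₗ[B] M, ∀ i, N.mkQ (F i) = f i := by
  obtain ⟨n, hn⟩ := hM
  have h2 := subsingleton_ext_of_finite_injectiveDimension hx hxr hxm hn hI
  have h1 : Subsingleton (Ext (ModuleCat.of B I) (ModuleCat.of B M) 1) :=
    (shortExact_ideal_quotient I).subsingleton_ext₁ (ModuleCat.of B M) 1
      (subsingleton_ext_ring _ 0) h2
  have hE : Function.Exact (LinearMap.lsmul B M z) N.mkQ := by
    intro w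
    rw [Submodule.mkQ_apply, Submodule.Quotient.mk_eq_zero, hN]
    rfl
  have hS := shortExact_of_linearMap (LinearMap.lsmul B M z) N.mkQ
    ((injective_iff_map_eq_zero _).2 hz) (Submodule.mkQ_surjective _) hE
  obtain ⟨e, he⟩ := Ext.covariant_sequence_exact₃ (X := ModuleCat.of B I) hS
    (Ext.mk₀ (ModuleCat.ofHom f)) (zero_add 1) (@Subsingleton.elim _ h1 _ _)
  obtain ⟨e, rfl⟩ := Ext.addEquiv₀.symm.surjective e
  rw [Ext.addEquiv₀_symm_apply, Ext.mk₀_comp_mk₀] at he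
  have he := Ext.addEquiv₀.symm.injective he
  refine ⟨e.hom, fun i => ?_⟩
  exact congrArg (fun t => t.hom i) he

end ExtDevissage

/-! ### Cyclic socles of `S/xS` and `ω/xω`. -/

section Socle

/-- The socle of `E` is zero or simple: it is generated by each of its nonzero elements. -/
def IsSocleCyclic (B : Type*) [CommRing B] [IsLocalRing B] (E : Type*) [AddCommGroup E]
    [Module B E] : Prop :=
  ∀ u v : E, u ≠ 0 → (∀ t ∈ maximalIdeal B, t • u = 0) → (∀ t ∈ maximalIdeal B, t • v = 0) →
    ∃ s : B, s • u = v

lemma exists_linearMap_sup_span {B : Type*} [CommRing B] {E : Type*} [AddCommGroup E] [Module B E]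
    (N : Ideal B) (u : B) (e : E) (h : ∀ r, r * u ∈ N → r • e = 0) :
    ∃ f : ↥(N ⊔ Ideal.span {u}) →ₗ[B] E, (∀ y (hy : y ∈ N), f ⟨y, Ideal.mem_sup_left hy⟩ = 0) ∧
      f ⟨u, Ideal.mem_sup_right (Ideal.mem_span_singleton_self u)⟩ = e := by
  let I := N ⊔ Ideal.span {u}
  let u' : I := ⟨u, Ideal.mem_sup_right (Ideal.mem_span_singleton_self u)⟩
  let N' : Submodule B I := Submodule.comap (Submodule.subtype I) N
  let g : B →ₗ[B] I ⧸ N' := LinearMap.toSpanSingleton B _ (N'.mkQ u')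
  have hg : Function.Surjective g := by
    intro y
    obtain ⟨⟨y, hy⟩, rfl⟩ := N'.mkQ_surjective y
    obtain ⟨n, hn, z, hz, rfl⟩ := Submodule.mem_sup.1 hy
    obtain ⟨c, rfl⟩ := Ideal.mem_span_singleton'.1 hz
    refine ⟨c, ?_⟩
    rw [LinearMap.toSpanSingleton_apply, ← map_smul, Submodule.mkQ_apply, Submodule.mkQ_apply,
      Submodule.Quotient.eq]
    simpa [N', u'] using hn
  have hker : LinearMap.ker g ≤ LinearMap.ker (LinearMap.toSpanSingleton B E e) := by
    intro r hr
    rw [LinearMap.mem_ker, LinearMap.toSpanSingleton_apply, ← map_smul, Submodule.mkQ_apply,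
      Submodule.Quotient.mk_eq_zero] at hr
    exact h r hr
  let q := g.quotKerEquivOfSurjective hg
  have hq : q.symm (N'.mkQ u') = Submodule.Quotient.mk 1 := by
    rw [LinearEquiv.symm_apply_eq, LinearMap.quotKerEquivOfSurjective_apply_mk]
    simp [g]
  refine ⟨(LinearMap.ker g).liftQ _ hker ∘ₗ q.symm.toLinearMap ∘ₗ N'.mkQ, fun y hy => ?_, ?_⟩
  · have : N'.mkQ ⟨y, Ideal.mem_sup_left hy⟩ = 0 := by
      rw [Submodule.mkQ_apply, Submodule.Quotient.mk_eq_zero]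
      exact hy
    rw [LinearMap.comp_apply, LinearMap.comp_apply, this, map_zero, map_zero]
  · rw [LinearMap.comp_apply, LinearMap.comp_apply, LinearEquiv.coe_coe]
    erw [hq]
    rw [Submodule.liftQ_apply, LinearMap.toSpanSingleton_apply, one_smul]

/-- Given socle elements `u ≠ 0` and `v`, the map `(x, u) → B/x` with `x ↦ 0`, `u ↦ v` lifts to some
`F` with values in `B`. Then `F x = s x`, and `x F(u) = u F(x)` forces `F u = s u`, so `v = s u`. -/
lemma isSocleCyclic_quotient_of_finite_injectiveDimension {B : Type u} [CommRing B] [IsLocalRing B]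
    [IsNoetherianRing B] {x : B} (hx : ∀ P : Ideal B, P.IsPrime → x ∈ P → P = maximalIdeal B)
    (hxr : ∀ t, t * x = 0 → t = 0) (hxm : x ∈ maximalIdeal B)
    (hB : HasFiniteInjectiveDimension B B) : IsSocleCyclic B (B ⧸ Ideal.span {x}) := by
  intro u v hu0 hu hv
  obtain ⟨u, rfl⟩ := Ideal.Quotient.mk_surjective u
  have h : ∀ r, r * u ∈ Ideal.span {x} → r • v = 0 := by
    intro r hr
    by_cases hrm : r ∈ maximalIdeal B
    · exact hv r hrm
    · have hr1 : IsUnit r := by simpa using hrm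
      refine absurd (Ideal.Quotient.eq_zero_iff_mem.2 ?_) hu0
      exact (Ideal.unit_mul_mem_iff_mem _ hr1).1 hr
  obtain ⟨f, hf0, hfu⟩ := exists_linearMap_sup_span _ u v h
  have hxI : x ∈ Ideal.span {x} ⊔ Ideal.span {u} :=
    Ideal.mem_sup_left (Ideal.mem_span_singleton_self x)
  obtain ⟨F, hF⟩ := exists_lift_of_finite_injectiveDimension hx hxr hxm hB hxI
    (z := x) (fun w hw => hxr w (by rwa [mul_comm])) (N := Ideal.span {x})
    (fun w => by simp [Ideal.mem_span_singleton, dvd_def, eq_comm]) f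
  have hFx := hF ⟨x, hxI⟩
  rw [hf0 x (Ideal.mem_span_singleton_self x), Submodule.mkQ_apply, Submodule.Quotient.mk_eq_zero,
    Ideal.mem_span_singleton'] at hFx
  obtain ⟨s, hs⟩ := hFx
  have huI : u ∈ Ideal.span {x} ⊔ Ideal.span {u} :=
    Ideal.mem_sup_right (Ideal.mem_span_singleton_self u)
  have e1 : x * F ⟨u, huI⟩ = u * F ⟨x, hxI⟩ := by
    rw [← smul_eq_mul, ← smul_eq_mul, ← map_smul, ← map_smul]
    congr 1
    exact Subtype.ext (mul_comm _ _)
  have e2 : F ⟨u, huI⟩ = s * u := by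
    rw [← sub_eq_zero]
    apply hxr
    rw [sub_mul, mul_comm _ x, e1, ← hs]
    ring
  refine ⟨s, ?_⟩
  rw [← hfu, ← hF ⟨u, huI⟩, e2]
  rfl

lemma isSocleCyclic_quotient_of_isGorensteinRing {B : Type u} [CommRing B] [IsLocalRing B]
    {x : B} (hx : ∀ P : Ideal B, P.IsPrime → x ∈ P → P = maximalIdeal B)
    (hxr : ∀ t, t * x = 0 → t = 0) (hxm : x ∈ maximalIdeal B)
    (hB : IsGorensteinRing B) : IsSocleCyclic B (B ⧸ Ideal.span {x}) := by
  have := hB.1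
  -- The Gorenstein condition speaks of localizations; a local ring is its own localization at the
  -- maximal ideal, so the result is transported along `e`.
  let B' := Localization.AtPrime (maximalIdeal B)
  have hunit : (maximalIdeal B).primeCompl ≤ IsUnit.submonoid B := by
    intro t ht
    have : t ∉ maximalIdeal B := ht
    simpa [IsUnit.mem_submonoid_iff] using this
  let e : B ≃ₐ[B] B' := IsLocalization.atUnits B (maximalIdeal B).primeCompl hunit
  have hN : IsNoetherianRing B' := isNoetherianRing_of_ringEquiv B e.toRingEquiv
  have hem : ∀ t, e t ∈ maximalIdeal B' ↔ t ∈ maximalIdeal B := by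
    intro t
    simp
  have hx' : ∀ P : Ideal B', P.IsPrime → e x ∈ P → P = maximalIdeal B' := by
    intro P hP hxP
    apply Ideal.comap_injective_of_surjective e.toRingEquiv.toRingHom e.surjective
    rw [hx (P.comap e.toRingEquiv.toRingHom) inferInstance hxP]
    ext t
    exact (hem t).symm
  have key := isSocleCyclic_quotient_of_finite_injectiveDimension hx'
    (fun t ht => by
      obtain ⟨t, rfl⟩ := e.surjective t
      rw [← map_mul, map_eq_zero_iff e e.injective] at ht
      rw [hxr t ht, map_zero]) ((hem x).2 hxm) (hB.2 (maximalIdeal B))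
  have hex : ∀ t, e t ∈ Ideal.span {e x} ↔ t ∈ Ideal.span {x} := by
    intro t
    rw [Ideal.mem_span_singleton, Ideal.mem_span_singleton]
    exact map_dvd_iff e
  intro u v hu0 hu hv
  obtain ⟨u, rfl⟩ := Submodule.Quotient.mk_surjective _ u
  obtain ⟨v, rfl⟩ := Submodule.Quotient.mk_surjective _ v
  simp only [← Submodule.Quotient.mk_smul, Submodule.Quotient.mk_eq_zero, ne_eq, smul_eq_mul]
    at hu0 hu hv
  obtain ⟨s, hs⟩ := key (Submodule.Quotient.mk (e u)) (Submodule.Quotient.mk (e v))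
    (by rwa [ne_eq, Submodule.Quotient.mk_eq_zero, hex])
    (fun t ht => by
      obtain ⟨t, rfl⟩ := e.surjective t
      rw [← Submodule.Quotient.mk_smul, Submodule.Quotient.mk_eq_zero, smul_eq_mul, ← map_mul, hex]
      exact hu t ((hem t).1 ht))
    (fun t ht => by
      obtain ⟨t, rfl⟩ := e.surjective t
      rw [← Submodule.Quotient.mk_smul, Submodule.Quotient.mk_eq_zero, smul_eq_mul, ← map_mul, hex]
      exact hv t ((hem t).1 ht))
  obtain ⟨s, rfl⟩ := e.surjective s
  refine ⟨s, ?_⟩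
  rw [← Submodule.Quotient.mk_smul, Submodule.Quotient.eq, smul_eq_mul, ← map_mul, ← map_sub,
    hex] at hs
  rwa [← Submodule.Quotient.mk_smul, Submodule.Quotient.eq]

/-- If `x` is regular on `ω` and `Ext¹(k, ω)` is simple, then the socle of `ω / xω` is cyclic. -/
lemma isSocleCyclic_quotient_of_length_ext {R : Type u} [CommRing R] [IsLocalRing R]
    {ω : Type u} [AddCommGroup ω] [Module R ω] {x : R} (hxm : x ∈ maximalIdeal R)
    (hxω : ∀ w : ω, x • w = 0 → w = 0) {N : Submodule R ω} (hN : ∀ w, w ∈ N ↔ ∃ v, x • v = w)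
    (hext : Module.length R (Abelian.Ext (ModuleCat.of R (ResidueField R))
      (ModuleCat.of R ω) 1) = 1) : IsSocleCyclic R (ω ⧸ N) := by
  intro u v hu0 hu hv
  have hE : Function.Exact (LinearMap.lsmul R ω x) N.mkQ := by
    intro w
    rw [Submodule.mkQ_apply, Submodule.Quotient.mk_eq_zero, hN]
    rfl
  have hS := shortExact_of_linearMap (LinearMap.lsmul R ω x) N.mkQ
    ((injective_iff_map_eq_zero _).2 hxω) (Submodule.mkQ_surjective _) hE
  have hex : ∀ w : ω ⧸ N, (∀ t ∈ maximalIdeal R, t • w = 0) →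
      ∃ f : ResidueField R →ₗ[R] ω ⧸ N, f 1 = w := fun w hw =>
    ⟨(maximalIdeal R).liftQ (LinearMap.toSpanSingleton R _ w) hw, one_smul R w⟩
  -- The connecting map `Hom(k, ω/xω) → Ext¹(k, ω)` is injective: `x` kills `k` and is regular on
  -- `ω`, so `Hom(k, ω) = 0`. Simplicity of `Ext¹(k, ω)` then passes to the socle.
  have hinj : ∀ f : ResidueField R →ₗ[R] ω ⧸ N,
      (Ext.mk₀ (ModuleCat.ofHom f)).comp hS.extClass (zero_add 1) = 0 → f = 0 := by
    intro f hf
    obtain ⟨g, hg⟩ := Ext.covariant_sequence_exact₃ (X := ModuleCat.of R (ResidueField R)) hS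
      (Ext.mk₀ (ModuleCat.ofHom f)) (zero_add 1) hf
    obtain ⟨g, rfl⟩ := Ext.addEquiv₀.symm.surjective g
    rw [Ext.addEquiv₀_symm_apply, Ext.mk₀_comp_mk₀] at hg
    have hg := Ext.addEquiv₀.symm.injective hg
    have hg0 : ∀ a, g.hom a = 0 := by
      intro a
      apply hxω
      rw [← map_smul]
      have : x • a = 0 := by
        change ResidueField R at a
        rw [Algebra.smul_def, ResidueField.algebraMap_eq, (residue_eq_zero_iff x).2 hxm, zero_mul]
      rw [this, map_zero]
    ext a
    have h1 := congrArg (fun t => t.hom a) hg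
    have h2 : N.mkQ (g.hom a) = f a := h1
    rw [← h2, hg0, map_zero]
    rfl
  obtain ⟨f, rfl⟩ := hex u hu
  obtain ⟨g, rfl⟩ := hex v hv
  have hsimple := Module.length_eq_one_iff.1 hext
  have hne : (Ext.mk₀ (ModuleCat.ofHom f)).comp hS.extClass (zero_add 1) ≠ 0 := fun h =>
    hu0 (by rw [hinj f h]; rfl)
  obtain ⟨s, hs⟩ := (isSimpleModule_iff_toSpanSingleton_surjective.1 hsimple).2 _ hne
    ((Ext.mk₀ (ModuleCat.ofHom g)).comp hS.extClass (zero_add 1))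
  refine ⟨s, ?_⟩
  have h0 : s • f - g = 0 := by
    apply hinj
    have : ModuleCat.ofHom (s • f - g) = s • ModuleCat.ofHom f - ModuleCat.ofHom g := rfl
    rw [this, sub_eq_add_neg, Ext.mk₀_add, Ext.mk₀_neg, Ext.mk₀_smul, Ext.add_comp, Ext.neg_comp,
      Ext.smul_comp, ← sub_eq_add_neg, sub_eq_zero]
    exact hs
  exact congrArg (fun t => t 1) (sub_eq_zero.1 h0)

end Socle

/-! ### Length bounds for Hom into a module with cyclic socle. -/

section Length

variable {B : Type*} [CommRing B] [IsLocalRing B]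

lemma IsLocalRing.smul_eq_zero_of_isSimpleModule {Q : Type*} [AddCommGroup Q] [Module B Q]
    [IsSimpleModule B Q] {t : B} (ht : t ∈ maximalIdeal B) (q : Q) : t • q = 0 := by
  obtain ⟨I, hI, ⟨e⟩⟩ := isSimpleModule_iff_quot_maximal.1 ‹IsSimpleModule B Q›
  rw [eq_maximalIdeal hI] at e
  apply e.injective
  rw [map_smul, map_zero]
  obtain ⟨a, ha⟩ := Submodule.Quotient.mk_surjective _ (e q)
  rw [← ha, ← Submodule.Quotient.mk_smul, Submodule.Quotient.mk_eq_zero]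
  exact Ideal.mul_mem_right _ _ ht

lemma length_hom_le_one_of_isSimpleModule {E : Type*} [AddCommGroup E] [Module B E]
    (hE : IsSocleCyclic B E) (Q : Type*) [AddCommGroup Q] [Module B Q] [IsSimpleModule B Q] :
    Module.length B (Q →ₗ[B] E) ≤ 1 := by
  by_cases hnt : Nontrivial (Q →ₗ[B] E)
  · refine (Module.length_eq_one_iff.2
      (isSimpleModule_iff_toSpanSingleton_surjective.2 ⟨hnt, fun f hf g => ?_⟩)).le
    obtain ⟨q, hq⟩ : ∃ q, f q ≠ 0 := by
      by_contra! h
      exact hf (LinearMap.ext h)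
    have hq0 : q ≠ 0 := fun h => hq (by rw [h, map_zero])
    obtain ⟨s, hs⟩ := hE (f q) (g q) hq
      (fun t ht => by rw [← map_smul, smul_eq_zero_of_isSimpleModule ht, map_zero])
      (fun t ht => by rw [← map_smul, smul_eq_zero_of_isSimpleModule ht, map_zero])
    refine ⟨s, LinearMap.ext fun y => ?_⟩
    obtain ⟨r, rfl⟩ := (isSimpleModule_iff_toSpanSingleton_surjective.1 ‹IsSimpleModule B Q›).2 q
      hq0 y
    simp only [LinearMap.toSpanSingleton_apply, LinearMap.smul_apply, map_smul]
    rw [← hs, smul_comm]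
  · rw [not_nontrivial_iff_subsingleton] at hnt
    rw [Module.length_eq_zero]
    exact zero_le_one

/-- Hom is left exact, so along a composition series each simple factor contributes at most one. -/
lemma length_hom_le {E : Type*} [AddCommGroup E] [Module B E] (hE : IsSocleCyclic B E)
    {N : Type*} [AddCommGroup N] [Module B N] (hN : IsFiniteLength B N) :
    Module.length B (N →ₗ[B] E) ≤ Module.length B N := by
  induction hN with
  | of_subsingleton =>
    rw [Module.length_eq_zero]
    exact zero_le
  | @of_simple_quotient M _ _ N _ hN ih =>
    have h1 := length_hom_le_one_of_isSimpleModule hE (M ⧸ N)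
    let i : ((M ⧸ N) →ₗ[B] E) →ₗ[B] (M →ₗ[B] E) := LinearMap.lcomp B E N.mkQ
    let p : (M →ₗ[B] E) →ₗ[B] (N →ₗ[B] E) := LinearMap.lcomp B E N.subtype
    have hi : Function.Injective i := fun f g h => by
      ext y
      exact congrArg (fun t => t y) h
    have hE' : Function.Exact i p.rangeRestrict := by
      intro f
      rw [← Submodule.coe_eq_zero, LinearMap.codRestrict_apply]
      constructor
      · intro h
        exact ⟨N.liftQ f fun y hy => LinearMap.congr_fun h ⟨y, hy⟩, by ext; rfl⟩
      · rintro ⟨g, rfl⟩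
        ext y
        change g (N.mkQ y) = 0
        rw [Submodule.mkQ_apply, (Submodule.Quotient.mk_eq_zero N).2 y.2, map_zero]
    rw [Module.length_eq_add_of_exact i p.rangeRestrict hi p.surjective_rangeRestrict hE',
      Module.length_eq_add_of_exact N.subtype N.mkQ N.subtype_injective N.mkQ_surjective
        (LinearMap.exact_subtype_mkQ N), add_comm, Module.length_eq_one B (M ⧸ N)]
    exact add_le_add ((Module.length_le_of_injective _ p.range.injective_subtype).trans ih) h1

/-- `N` is a finite module over `B/x`, which is Artinian because all its primes are maximal. -/
lemma length_ne_top_of_smul_eq_zero [IsNoetherianRing B] {x : B}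
    (hx : ∀ P : Ideal B, P.IsPrime → x ∈ P → P = maximalIdeal B)
    (N : Type*) [AddCommGroup N] [Module B N] [Module.Finite B N] (hN : ∀ y : N, x • y = 0) :
    Module.length B N ≠ ⊤ := by
  let I := Ideal.span {x}
  have hI : Module.IsTorsionBySet B N I := by
    rw [Module.isTorsionBySet_span_singleton_iff]
    exact fun y => hN y
  let _ : Module (B ⧸ I) N := hI.module
  have : IsScalarTower B (B ⧸ I) N := hI.isScalarTower
  have : IsArtinianRing (B ⧸ I) := by
    rw [isArtinianRing_iff_isNoetherianRing_krullDimLE_zero, Ring.krullDimLE_zero_iff]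
    refine ⟨inferInstance, fun P hP => ?_⟩
    have := hx (P.comap (Ideal.Quotient.mk I)) inferInstance (by
      rw [Ideal.mem_comap, Ideal.Quotient.eq_zero_iff_mem.2 (Ideal.mem_span_singleton_self x)]
      exact P.zero_mem)
    have : (P.comap (Ideal.Quotient.mk I)).IsMaximal := by
      rw [this]
      exact maximalIdeal.isMaximal B
    rw [← Ideal.map_comap_of_surjective _ Ideal.Quotient.mk_surjective P]
    refine (Ideal.map_eq_top_or_isMaximal_of_surjective _ Ideal.Quotient.mk_surjective
      this).resolve_left fun h => hP.ne_top ?_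
    rwa [Ideal.map_comap_of_surjective _ Ideal.Quotient.mk_surjective P] at h
  have : Module.Finite (B ⧸ I) N := Module.Finite.of_restrictScalars_finite B _ _
  rw [Module.length_eq_of_surjective (R := B ⧸ I) Ideal.Quotient.mk_surjective]
  exact Module.length_ne_top

end Length

/-! ### Length comparisons and reduction modulo `x`. -/

section Trace

lemma surjective_of_injective_of_length_le {B M N : Type*} [CommRing B] [AddCommGroup M]
    [AddCommGroup N] [Module B M] [Module B N] (f : M →ₗ[B] N) (hf : Function.Injective f)
    (hle : Module.length B N ≤ Module.length B M) (hM : Module.length B M ≠ ⊤) :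
    Function.Surjective f := by
  have h := Module.length_eq_add_of_exact f (LinearMap.range f).mkQ hf
    (Submodule.mkQ_surjective _) (LinearMap.exact_map_mkQ_range f)
  rw [h] at hle
  have h0 : Module.length B (N ⧸ LinearMap.range f) = 0 := by
    have : Module.length B (N ⧸ LinearMap.range f) ≤ 0 :=
      (ENat.add_le_add_iff_left hM).1 (by rwa [add_zero])
    exact nonpos_iff_eq_zero.1 this
  rw [Module.length_eq_zero_iff, Submodule.Quotient.subsingleton_iff] at h0
  exact LinearMap.range_eq_top.1 h0

lemma length_quotient_eq_add {B M : Type*} [CommRing B] [AddCommGroup M] [Module B M]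
    {P Q : Submodule B M} (h : P ≤ Q) :
    Module.length B (M ⧸ P) =
      Module.length B (Q ⧸ P.submoduleOf Q) + Module.length B (M ⧸ Q) := by
  refine Module.length_eq_add_of_exact (Submodule.mapQ (P.submoduleOf Q) P Q.subtype fun _ => id)
    (Submodule.factor h) ?_ (Submodule.factor_surjective h) ?_
  · rw [injective_iff_map_eq_zero]
    intro a
    obtain ⟨a, rfl⟩ := Submodule.Quotient.mk_surjective _ a
    change (Submodule.Quotient.mk (a : M) : M ⧸ P) = 0 → _
    rw [Submodule.Quotient.mk_eq_zero, Submodule.Quotient.mk_eq_zero]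
    exact id
  · intro a
    obtain ⟨a, rfl⟩ := Submodule.Quotient.mk_surjective _ a
    change (Submodule.Quotient.mk a : M ⧸ Q) = 0 ↔ _
    rw [Submodule.Quotient.mk_eq_zero]
    constructor
    · intro ha
      exact ⟨Submodule.Quotient.mk ⟨a, ha⟩, rfl⟩
    · rintro ⟨b, hb⟩
      obtain ⟨b, rfl⟩ := Submodule.Quotient.mk_surjective _ b
      change (Submodule.Quotient.mk (b : M) : M ⧸ P) = _ at hb
      rw [eq_comm, Submodule.Quotient.eq] at hb
      have := Q.add_mem (h hb) b.2
      simpa using this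

variable {R : Type*} [CommRing R]

/-- The submodule `xM` of `M`. -/
abbrev smulRange (x : R) (M : Type*) [AddCommGroup M] [Module R M] : Submodule R M :=
  LinearMap.range (LinearMap.lsmul R M x)

lemma mem_smulRange {x : R} {M : Type*} [AddCommGroup M] [Module R M] {w : M} :
    w ∈ smulRange x M ↔ ∃ v, x • v = w := Iff.rfl

variable [IsLocalRing R]

lemma eq_top_of_sup_smulRange_eq_top {x : R} (hxm : x ∈ maximalIdeal R) {M : Type*}
    [AddCommGroup M] [Module R M] [Module.Finite R M] {N : Submodule R M}
    (h : N ⊔ smulRange x M = ⊤) : N = ⊤ := by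
  refine top_le_iff.1 (Submodule.le_of_le_smul_of_le_jacobson_bot (I := maximalIdeal R)
    Module.Finite.fg_top (maximalIdeal_le_jacobson _) ?_)
  rw [← h]
  refine sup_le_sup_left ?_ N
  rintro _ ⟨w, rfl⟩
  exact Submodule.smul_mem_smul hxm (h ▸ Submodule.mem_top)

variable [IsNoetherianRing R] {x : R}
  (hx : ∀ P : Ideal R, P.IsPrime → x ∈ P → P = maximalIdeal R)

include hx in
lemma exists_socle_quotient_smulRange (hxm : x ∈ maximalIdeal R) (M : Type*)
    [AddCommGroup M] [Module R M] [Module.Finite R M] [Nontrivial M] :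
    ∃ u : M, u ∉ smulRange x M ∧ ∀ t, t • u ∈ smulRange x M ↔ t ∈ maximalIdeal R := by
  have hne : smulRange x M ≠ ⊤ := fun h =>
    bot_ne_top (eq_top_of_sup_smulRange_eq_top (M := M) (N := ⊥) hxm (by rwa [bot_sup_eq]))
  obtain ⟨w, -, hw⟩ := SetLike.exists_of_lt (lt_top_iff_ne_top.2 hne)
  obtain ⟨r, hr, h⟩ := exists_smul_mem_socle hx (w := (smulRange x M).mkQ w)
    (by rwa [Submodule.mkQ_apply, ne_eq, Submodule.Quotient.mk_eq_zero])
    (by rw [← map_smul, Submodule.mkQ_apply, Submodule.Quotient.mk_eq_zero]; exact ⟨w, rfl⟩)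
  refine ⟨r • w, ?_, fun t => ?_⟩
  · rwa [← map_smul, Submodule.mkQ_apply, ne_eq, Submodule.Quotient.mk_eq_zero] at hr
  · rw [← h t, ← map_smul, ← map_smul, Submodule.mkQ_apply, Submodule.Quotient.mk_eq_zero]

-- Compute `ℓ(R/xc)` through `c` and through `xR`, where `xR/xc ≅ R/c`; then cancel the finite
-- `ℓ(R/c)`.
include hx in
lemma length_quotient_span_eq (hxr : ∀ t, t * x = 0 → t = 0) {c : Ideal R} (hxc : x ∈ c) :
    Module.length R (R ⧸ Ideal.span {x}) = Module.length R (c ⧸ smulRange x c) := by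
  let J : Ideal R := Ideal.span {x} * c
  have hJ : ∀ y, y ∈ J ↔ ∃ z ∈ c, x * z = y := fun y => Ideal.mem_span_singleton_mul
  have h1 : Module.length R (R ⧸ J) =
      Module.length R (c ⧸ smulRange x c) + Module.length R (R ⧸ c) := by
    rw [length_quotient_eq_add (show J ≤ c from Ideal.mul_le_right)]
    have : J.submoduleOf c = smulRange x c := by
      ext y
      change (y : R) ∈ J ↔ _
      rw [hJ, mem_smulRange]
      constructor
      · rintro ⟨z, hz, h⟩
        exact ⟨⟨z, hz⟩, Subtype.ext h⟩
      · rintro ⟨z, h⟩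
        exact ⟨z, z.2, congrArg Subtype.val h⟩
    rw [this]
  have h2 : Module.length R (R ⧸ J) =
      Module.length R (R ⧸ c) + Module.length R (R ⧸ Ideal.span {x}) := by
    refine Module.length_eq_add_of_exact
      (Submodule.mapQ c J (LinearMap.mulLeft R x) fun z hz => (hJ _).2 ⟨z, hz, rfl⟩)
      (Submodule.factor (show J ≤ Ideal.span {x} from Ideal.mul_le_left)) ?_
      (Submodule.factor_surjective _) ?_
    · rw [injective_iff_map_eq_zero]
      intro a
      obtain ⟨a, rfl⟩ := Submodule.Quotient.mk_surjective _ a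
      rw [Submodule.mapQ_apply, Submodule.Quotient.mk_eq_zero, Submodule.Quotient.mk_eq_zero, hJ]
      rintro ⟨z, hz, h⟩
      have : z = a := sub_eq_zero.1 (hxr _ (by
        rw [LinearMap.mulLeft_apply] at h
        rw [sub_mul, mul_comm z, mul_comm a, h, sub_self]))
      rwa [← this]
    · intro a
      obtain ⟨a, rfl⟩ := Submodule.Quotient.mk_surjective _ a
      change (Submodule.Quotient.mk a : R ⧸ Ideal.span {x}) = 0 ↔ _
      rw [Submodule.Quotient.mk_eq_zero, Ideal.mem_span_singleton']
      constructor
      · rintro ⟨z, rfl⟩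
        refine ⟨Submodule.Quotient.mk z, ?_⟩
        rw [Submodule.mapQ_apply, LinearMap.mulLeft_apply, mul_comm]
      · rintro ⟨b, hb⟩
        obtain ⟨b, rfl⟩ := Submodule.Quotient.mk_surjective _ b
        rw [Submodule.mapQ_apply, eq_comm, Submodule.Quotient.eq, hJ] at hb
        obtain ⟨z, -, hz⟩ := hb
        rw [LinearMap.mulLeft_apply] at hz
        exact ⟨z + b, by rw [add_mul, mul_comm z, hz, mul_comm b]; ring⟩
  have hfin : Module.length R (R ⧸ c) ≠ ⊤ := by
    refine length_ne_top_of_smul_eq_zero hx _ fun y => ?_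
    obtain ⟨y, rfl⟩ := Submodule.Quotient.mk_surjective _ y
    rw [← Submodule.Quotient.mk_smul, Submodule.Quotient.mk_eq_zero]
    exact Ideal.mul_mem_right _ _ hxc
  rw [h1, add_comm] at h2
  exact (WithTop.add_left_cancel hfin h2).symm

end Trace

/-! ### Identifying an ideal with the canonical module. -/

section Canonical

variable {R : Type u} [CommRing R] [IsLocalRing R] [IsNoetherianRing R] {x : R}
  (hx : ∀ P : Ideal R, P.IsPrime → x ∈ P → P = maximalIdeal R)
  (hxr : ∀ t, t * x = 0 → t = 0) (hxm : x ∈ maximalIdeal R)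
  {ω : Type u} [AddCommGroup ω] [Module R ω]

include hx hxr hxm

/-- A map `c → ω` sending a socle generator of `c / xc` to one of `ω / xω`. -/
lemma exists_linearMap_not_mem_smulRange [Module.Finite R ω] [Nontrivial ω]
    (hω : HasFiniteInjectiveDimension R ω) (hxω : ∀ w : ω, x • w = 0 → w = 0) {c : Ideal R}
    (hxc : x ∈ c) {u : c} (hu : ∀ t, t • u ∈ smulRange x c ↔ t ∈ maximalIdeal R) :
    ∃ G : c →ₗ[R] ω, G u ∉ smulRange x ω := by
  obtain ⟨e, he0, he⟩ := exists_socle_quotient_smulRange hx hxm ω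
  let J : Ideal R := Ideal.span {x} * c
  have hJ : ∀ y, y ∈ J ↔ ∃ z ∈ c, x * z = y := fun y => Ideal.mem_span_singleton_mul
  obtain ⟨f, hf0, hfu⟩ := exists_linearMap_sup_span J (u : R) ((smulRange x ω).mkQ e) (by
    intro r hr
    obtain ⟨z, hz, h⟩ := (hJ _).1 hr
    rw [← map_smul, Submodule.mkQ_apply, Submodule.Quotient.mk_eq_zero, he, ← hu]
    exact ⟨⟨z, hz⟩, Subtype.ext h⟩)
  -- The ideal `xc + (u)` need not contain `x`, so the lifting lemma is applied with `x²`.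
  have hxx : x * x ∈ J ⊔ Ideal.span {(u : R)} := Ideal.mem_sup_left ((hJ _).2 ⟨x, hxc, rfl⟩)
  obtain ⟨F, hF⟩ := exists_lift_of_finite_injectiveDimension (x := x * x)
    (fun P hP h => hx P hP ((hP.mem_or_mem h).elim id id))
    (fun t ht => hxr _ (hxr _ (by rwa [mul_assoc]))) (Ideal.mul_mem_left _ _ hxm) hω hxx hxω
    (N := smulRange x ω) (fun w => mem_smulRange) f
  let m : c →ₗ[R] ↥(J ⊔ Ideal.span {(u : R)}) :=
    LinearMap.codRestrict _ (LinearMap.mulLeft R x ∘ₗ Submodule.subtype c)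
      fun t => Ideal.mem_sup_left ((hJ _).2 ⟨t, t.2, rfl⟩)
  have hFm : ∀ t, (F ∘ₗ m) t ∈ smulRange x ω := by
    intro t
    rw [← Submodule.Quotient.mk_eq_zero, ← Submodule.mkQ_apply, LinearMap.comp_apply, hF]
    exact hf0 _ ((hJ _).2 ⟨t, t.2, rfl⟩)
  let E := LinearEquiv.ofInjective (LinearMap.lsmul R ω x) ((injective_iff_map_eq_zero _).2 hxω)
  -- `F` maps `xc` into `xω`, so `G t = F(x t) / x` makes sense on all of `c`; it agrees with `F` at
  -- `u`.
  let G : c →ₗ[R] ω := E.symm.toLinearMap ∘ₗ LinearMap.codRestrict (smulRange x ω) (F ∘ₗ m) hFm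
  have hG : ∀ t, x • G t = F (m t) := fun t =>
    congrArg Subtype.val (E.apply_symm_apply ⟨F (m t), hFm t⟩)
  have huI : (u : R) ∈ J ⊔ Ideal.span {(u : R)} :=
    Ideal.mem_sup_right (Ideal.mem_span_singleton_self _)
  have hGu : G u = F ⟨u, huI⟩ := by
    rw [← sub_eq_zero]
    apply hxω
    rw [smul_sub, hG, ← map_smul, sub_eq_zero]
    rfl
  refine ⟨G, fun h => he0 ?_⟩
  rw [← Submodule.Quotient.mk_eq_zero, ← Submodule.mkQ_apply] at h ⊢
  rw [← hfu, ← hF ⟨u, huI⟩, ← hGu, h]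

/-- An ideal `c` containing `x` for which the socle of `c / xc` is simple is isomorphic to the
canonical module. -/
lemma nonempty_linearEquiv_of_isSocleCyclic [Module.Finite R ω] [Nontrivial ω]
    (hω : HasFiniteInjectiveDimension R ω) (hxω : ∀ w : ω, x • w = 0 → w = 0)
    (hE : IsSocleCyclic R (ω ⧸ smulRange x ω)) {c : Ideal R} (hxc : x ∈ c)
    (hc : IsSocleCyclic R (c ⧸ smulRange x c)) : Nonempty (c ≃ₗ[R] ω) := by
  have hx0 : x ≠ 0 := fun h => one_ne_zero (hxr 1 (by rw [h, mul_zero]))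
  have : Nontrivial c := ⟨⟨⟨x, hxc⟩, 0, fun h => hx0 (congrArg Subtype.val h)⟩⟩
  obtain ⟨u, hu0, hu⟩ := exists_socle_quotient_smulRange hx hxm c
  obtain ⟨G, hG⟩ := exists_linearMap_not_mem_smulRange hx hxr hxm hω hxω hxc hu
  have hmap : ∀ t ∈ smulRange x c, G t ∈ smulRange x ω := by
    rintro _ ⟨t, rfl⟩
    exact ⟨G t, (map_smul G x t).symm⟩
  let G' : (c ⧸ smulRange x c) →ₗ[R] ω ⧸ smulRange x ω := Submodule.mapQ _ _ G hmap
  -- A nonzero kernel element would have a nonzero socle multiple, of which `u` is a multiple modulo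
  -- `xc`; then `G u ∈ xω`.
  have hG' : Function.Injective G' := by
    rw [injective_iff_map_eq_zero]
    intro t ht
    by_contra ht0
    have hxt : x • t = 0 := by
      obtain ⟨t, rfl⟩ := Submodule.Quotient.mk_surjective _ t
      rw [← Submodule.Quotient.mk_smul, Submodule.Quotient.mk_eq_zero]
      exact ⟨t, rfl⟩
    obtain ⟨r, hr0, hr⟩ := exists_smul_mem_socle hx ht0 hxt
    obtain ⟨s, hs⟩ := hc _ ((smulRange x c).mkQ u) hr0 (fun a ha => (hr a).2 ha) (fun a ha => by
      rw [← map_smul, Submodule.mkQ_apply, Submodule.Quotient.mk_eq_zero]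
      exact (hu a).2 ha)
    apply hG
    rw [← Submodule.Quotient.mk_eq_zero]
    change G' ((smulRange x c).mkQ u) = 0
    rw [← hs, map_smul, map_smul, ht, smul_zero, smul_zero]
  have hfin : ∀ (M : Type u) [AddCommGroup M] [Module R M] [Module.Finite R M],
      Module.length R (M ⧸ smulRange x M) ≠ ⊤ := by
    intro M _ _ _
    refine length_ne_top_of_smul_eq_zero hx _ fun y => ?_
    obtain ⟨y, rfl⟩ := Submodule.Quotient.mk_surjective _ y
    rw [← Submodule.Quotient.mk_smul, Submodule.Quotient.mk_eq_zero]
    exact ⟨y, rfl⟩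
  -- `ω/xω` is a quotient of `Hom(R/x, ω/xω)` by evaluation at `1`, so its length is at most `ℓ(R/x)
  -- = ℓ(c/xc)`.
  have hlen : Module.length R (ω ⧸ smulRange x ω) ≤ Module.length R (c ⧸ smulRange x c) := by
    rw [← length_quotient_span_eq hx hxr hxc]
    have hA : IsFiniteLength R (R ⧸ Ideal.span {x}) := by
      rw [← Module.length_ne_top_iff, length_quotient_span_eq hx hxr hxc]
      exact hfin c
    refine le_trans ?_ (length_hom_le hE hA)
    refine Module.length_le_of_surjective
      (LinearMap.applyₗ (Submodule.Quotient.mk 1 : R ⧸ Ideal.span {x})) fun w => ?_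
    refine ⟨(Ideal.span {x}).liftQ (LinearMap.toSpanSingleton R _ w) ?_, one_smul R w⟩
    rw [Ideal.span_singleton_le_iff_mem, LinearMap.mem_ker, LinearMap.toSpanSingleton_apply]
    obtain ⟨w, rfl⟩ := Submodule.Quotient.mk_surjective _ w
    rw [← Submodule.Quotient.mk_smul, Submodule.Quotient.mk_eq_zero]
    exact ⟨w, rfl⟩
  have hsurj := surjective_of_injective_of_length_le G' hG' hlen (hfin c)
  refine ⟨LinearEquiv.ofBijective G ⟨?_, ?_⟩⟩
  -- Injectivity modulo `x` and regularity of `x` on `ω` give `ker G ⊆ x ker G`; Nakayama applies.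
  · rw [← LinearMap.ker_eq_bot]
    refine Submodule.eq_bot_of_le_smul_of_le_jacobson_bot (maximalIdeal R) _
      (IsNoetherian.noetherian _) ?_ (maximalIdeal_le_jacobson _)
    intro t ht
    have h1 : G' (Submodule.Quotient.mk t) = 0 := by
      rw [Submodule.mapQ_apply, LinearMap.mem_ker.1 ht, Submodule.Quotient.mk_zero]
    obtain ⟨s, rfl⟩ := mem_smulRange.1
      ((Submodule.Quotient.mk_eq_zero _).1 (hG' (h1.trans (map_zero G').symm)))
    refine Submodule.smul_mem_smul hxm ?_
    rw [LinearMap.mem_ker, map_smul] at ht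
    exact hxω _ ht
  · rw [← LinearMap.range_eq_top]
    refine eq_top_of_sup_smulRange_eq_top hxm (top_le_iff.1 fun w _ => ?_)
    obtain ⟨t, ht⟩ := hsurj (Submodule.Quotient.mk w)
    obtain ⟨t, rfl⟩ := Submodule.Quotient.mk_surjective _ t
    rw [Submodule.mapQ_apply, eq_comm, Submodule.Quotient.eq] at ht
    exact Submodule.mem_sup.2 ⟨G t, ⟨t, rfl⟩, _, ht, by abel⟩

omit hx hxr hxm [IsLocalRing R] [IsNoetherianRing R] in
lemma le_traceIdeal_of_linearEquiv {c : Ideal R} (e : c ≃ₗ[R] ω) : c ≤ traceIdeal R ω := by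
  intro t ht
  refine (le_iSup (fun f : ω →ₗ[R] R => LinearMap.range f)
    (Submodule.subtype c ∘ₗ e.symm.toLinearMap)) ⟨e ⟨t, ht⟩, ?_⟩
  simp

end Canonical

/-! ### The conductor of a Gorenstein subring. -/

section Conductor

variable {R : Type*} [CommRing R] (S : Subring R)

/-- The conductor of `S` in `R`: the largest ideal of `R` contained in `S`. -/
def conductorIdeal : Ideal R where
  carrier := {r | ∀ r', r * r' ∈ S}
  add_mem' ha hb r' := by rw [add_mul]; exact S.add_mem (ha r') (hb r')
  zero_mem' r' := by rw [zero_mul]; exact S.zero_mem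
  smul_mem' a b hb r' := by rw [smul_eq_mul, mul_comm a b, mul_assoc]; exact hb _

variable {S}

lemma mem_conductorIdeal {r : R} : r ∈ conductorIdeal S ↔ ∀ r', r * r' ∈ S := Iff.rfl

/-- Multiplication by an element of the conductor, as an `S`-linear map `R → S`. -/
def mulConductor (u : R) (hu : u ∈ conductorIdeal S) : R →ₗ[S] S where
  toFun r := ⟨u * r, hu r⟩
  map_add' a b := Subtype.ext (mul_add u a b)
  map_smul' s a := Subtype.ext (by
    change u * ((s : R) * a) = (s : R) * (u * a)
    ring)

variable [IsLocalRing S] [IsNoetherianRing S] {x : S} (hxc : (x : R) ∈ conductorIdeal S)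
  (hx : ∀ P : Ideal S, P.IsPrime → x ∈ P → P = maximalIdeal S)
  (hxr : ∀ t : R, t * x = 0 → t = 0)
  (hE : IsSocleCyclic S (S ⧸ Ideal.span {x}))

include hxc hx hxr hE

/-- If `S` is Gorenstein then `ℓ(R/c) = 2 ℓ(R/S)` for the conductor `c`. -/
lemma length_quotient_conductorIdeal [Module.Finite S R] :
    Module.length S (R ⧸ (1 : Submodule S R)) ≠ ⊤ ∧
    Module.length S (R ⧸ (conductorIdeal S).restrictScalars S) =
      2 * Module.length S (R ⧸ (1 : Submodule S R)) := by
  let A : Ideal S := Ideal.span {x}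
  let μ : R →ₗ[S] S := mulConductor (x : R) hxc
  have hA : ∀ r, μ r ∈ A ↔ r ∈ S := by
    intro r
    rw [Ideal.mem_span_singleton']
    constructor
    · rintro ⟨s, hs⟩
      have hs : (s : R) * x = x * r := congrArg Subtype.val hs
      rw [← sub_eq_zero.1 (hxr ((s : R) - r) (by rw [sub_mul, hs]; ring))]
      exact s.2
    · exact fun hr => ⟨⟨r, hr⟩, Subtype.ext (mul_comm _ _)⟩
  have h1 : ∀ r : R, r ∈ (1 : Submodule S R) ↔ r ∈ S := by
    intro r
    rw [Submodule.mem_one]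
    exact ⟨fun ⟨s, hs⟩ => hs ▸ s.2, fun hr => ⟨⟨r, hr⟩, rfl⟩⟩
  have hfin : ∀ (N : Type _) [AddCommGroup N] [Module S N] [Module.Finite S N],
      (∀ y : N, x • y = 0) → IsFiniteLength S N := fun N _ _ _ h =>
    Module.length_ne_top_iff.1 (length_ne_top_of_smul_eq_zero hx N h)
  have hfR : IsFiniteLength S (R ⧸ (1 : Submodule S R)) := hfin _ fun y => by
    obtain ⟨y, rfl⟩ := Submodule.Quotient.mk_surjective _ y
    rw [← Submodule.Quotient.mk_smul, Submodule.Quotient.mk_eq_zero, h1]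
    exact hxc y
  have hfA : IsFiniteLength S (S ⧸ A) := hfin _ fun y => by
    obtain ⟨y, rfl⟩ := Submodule.Quotient.mk_surjective _ y
    rw [← Submodule.Quotient.mk_smul, Submodule.Quotient.mk_eq_zero]
    exact Ideal.mul_mem_right _ _ (Ideal.mem_span_singleton_self x)
  let A₂ : Ideal S := LinearMap.range μ
  have hfA₂ : IsFiniteLength S (S ⧸ A₂) := hfin _ fun y => by
    obtain ⟨y, rfl⟩ := Submodule.Quotient.mk_surjective _ y
    rw [← Submodule.Quotient.mk_smul, Submodule.Quotient.mk_eq_zero]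
    exact ⟨y, rfl⟩
  -- Multiplication by `x` embeds `R/S` in `S/xS` with cokernel `S/xR`. The annihilator `C` of `φ`
  -- is the conductor, viewed in `S`.
  let φ : (R ⧸ (1 : Submodule S R)) →ₗ[S] S ⧸ A := Submodule.mapQ _ A μ
    fun r hr => (hA r).2 ((h1 r).1 hr)
  have hφ : ∀ r, φ (Submodule.Quotient.mk r) = Submodule.Quotient.mk (μ r) := fun _ => rfl
  have hAA₂ : A ≤ A₂ := by
    rw [Ideal.span_singleton_le_iff_mem]
    exact ⟨1, Subtype.ext (mul_one _)⟩
  let C : Ideal S := LinearMap.ker (LinearMap.toSpanSingleton S _ φ)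
  have hC : ∀ s, s ∈ C ↔ (s : R) ∈ conductorIdeal S := by
    intro s
    have : ∀ r, s • φ (Submodule.Quotient.mk r) = 0 ↔ (s : R) * r ∈ S := by
      intro r
      rw [hφ, ← Submodule.Quotient.mk_smul, ← map_smul, Submodule.Quotient.mk_eq_zero, hA]
      rfl
    rw [LinearMap.mem_ker, LinearMap.toSpanSingleton_apply, mem_conductorIdeal]
    constructor
    · exact fun h r => (this r).1 (LinearMap.congr_fun h _)
    · intro h
      refine LinearMap.ext fun r => ?_
      obtain ⟨r, rfl⟩ := Submodule.Quotient.mk_surjective _ r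
      exact (this r).2 (h r)
  have hAC : A ≤ C := by
    rw [Ideal.span_singleton_le_iff_mem, hC]
    exact hxc
  -- `s ↦ s φ` embeds `S/C` in `Hom(R/S, S/xS)`.
  have le1 : Module.length S (S ⧸ C) ≤ Module.length S (R ⧸ (1 : Submodule S R)) := by
    refine le_trans ?_ (length_hom_le hE hfR)
    exact Module.length_le_of_injective (C.liftQ (LinearMap.toSpanSingleton S _ φ) le_rfl)
      (LinearMap.ker_eq_bot.1 (Submodule.ker_liftQ_eq_bot _ _ _ le_rfl))
  -- Elements of `C` multiply `xR` into `xS`, so they arise as values at `1` of maps `S/xR → S/xS`.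
  have le2 : Module.length S (C ⧸ A.submoduleOf C) ≤ Module.length S (S ⧸ A₂) := by
    refine le_trans ?_ (length_hom_le hE hfA₂)
    let ev : ((S ⧸ A₂) →ₗ[S] (S ⧸ A)) →ₗ[S] (S ⧸ A) :=
      LinearMap.applyₗ (Submodule.Quotient.mk 1 : S ⧸ A₂)
    let j : (C ⧸ A.submoduleOf C) →ₗ[S] (S ⧸ A) :=
      Submodule.mapQ (A.submoduleOf C) A (Submodule.subtype C) fun _ => id
    have hjval : ∀ s : C, j (Submodule.Quotient.mk s) = Submodule.Quotient.mk (s : S) :=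
      fun _ => rfl
    have hj : Function.Injective j := by
      rw [injective_iff_map_eq_zero]
      intro a
      obtain ⟨a, rfl⟩ := Submodule.Quotient.mk_surjective _ a
      rw [hjval, Submodule.Quotient.mk_eq_zero, Submodule.Quotient.mk_eq_zero]
      exact id
    have hjr : ∀ a, j a ∈ LinearMap.range ev := by
      intro a
      obtain ⟨⟨a, ha⟩, rfl⟩ := Submodule.Quotient.mk_surjective _ a
      refine ⟨Submodule.mapQ A₂ A (LinearMap.mulLeft S a) ?_, ?_⟩
      · rintro _ ⟨r, rfl⟩
        rw [Submodule.mem_comap, LinearMap.mulLeft_apply, ← smul_eq_mul, ← map_smul, hA]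
        exact (hC a).1 ha r
      · change Submodule.Quotient.mk (a * 1) = _
        rw [mul_one]
        rfl
    exact (Module.length_le_of_injective (j.codRestrict _ hjr) fun a b h =>
      hj (congrArg Subtype.val h)).trans (Module.length_le_of_surjective _ ev.surjective_rangeRestrict)
  have eq1 := length_quotient_eq_add hAC
  have eq2 : Module.length S (S ⧸ A) =
      Module.length S (R ⧸ (1 : Submodule S R)) + Module.length S (S ⧸ A₂) := by
    refine Module.length_eq_add_of_exact φ (Submodule.factor hAA₂) ?_
      (Submodule.factor_surjective _) ?_
    · rw [injective_iff_map_eq_zero]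
      intro r
      obtain ⟨r, rfl⟩ := Submodule.Quotient.mk_surjective _ r
      rw [hφ, Submodule.Quotient.mk_eq_zero, Submodule.Quotient.mk_eq_zero, hA, h1]
      exact id
    · intro a
      obtain ⟨a, rfl⟩ := Submodule.Quotient.mk_surjective _ a
      change (Submodule.Quotient.mk a : S ⧸ A₂) = 0 ↔ _
      rw [Submodule.Quotient.mk_eq_zero]
      constructor
      · rintro ⟨r, rfl⟩
        exact ⟨Submodule.Quotient.mk r, rfl⟩
      · rintro ⟨r, hr⟩
        obtain ⟨r, rfl⟩ := Submodule.Quotient.mk_surjective _ r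
        rw [hφ, eq_comm, Submodule.Quotient.eq] at hr
        have := A₂.add_mem (hAA₂ hr) ⟨r, rfl⟩
        rwa [sub_add_cancel] at this
  have eq3 : Module.length S (R ⧸ (conductorIdeal S).restrictScalars S) =
      Module.length S (S ⧸ C) + Module.length S (R ⧸ (1 : Submodule S R)) := by
    have hle : (conductorIdeal S).restrictScalars S ≤ (1 : Submodule S R) := fun r hr =>
      (h1 r).2 (by simpa using mem_conductorIdeal.1 hr 1)
    have hι : C ≤ ((conductorIdeal S).restrictScalars S).comap (Algebra.linearMap S R) :=
      fun s hs => (hC s).1 hs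
    refine Module.length_eq_add_of_exact (Submodule.mapQ C _ (Algebra.linearMap S R) hι)
      (Submodule.factor hle) ?_ (Submodule.factor_surjective _) ?_
    · rw [injective_iff_map_eq_zero]
      intro s
      obtain ⟨s, rfl⟩ := Submodule.Quotient.mk_surjective _ s
      rw [Submodule.mapQ_apply, Submodule.Quotient.mk_eq_zero, Submodule.Quotient.mk_eq_zero, hC]
      exact id
    · intro a
      obtain ⟨a, rfl⟩ := Submodule.Quotient.mk_surjective _ a
      change (Submodule.Quotient.mk a : R ⧸ (1 : Submodule S R)) = 0 ↔ _
      rw [Submodule.Quotient.mk_eq_zero, h1]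
      constructor
      · intro ha
        exact ⟨Submodule.Quotient.mk ⟨a, ha⟩, rfl⟩
      · rintro ⟨s, hs⟩
        obtain ⟨s, rfl⟩ := Submodule.Quotient.mk_surjective _ s
        rw [Submodule.mapQ_apply, eq_comm, Submodule.Quotient.eq] at hs
        have hs : a - (s : R) ∈ S := (h1 _).1 (hle hs)
        have := S.add_mem hs s.2
        rwa [sub_add_cancel] at this
  rw [← Module.length_ne_top_iff] at hfR hfA hfA₂
  refine ⟨hfR, ?_⟩
  have hCfin : Module.length S (S ⧸ C) ≠ ⊤ := ne_top_of_le_ne_top hfR le1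
  have hCAfin : Module.length S (C ⧸ A.submoduleOf C) ≠ ⊤ := ne_top_of_le_ne_top hfA₂ le2
  -- By `eq1` and `eq2`, the left sides of `le1` and `le2` add up to `ℓ(S/xS)`, as do the right
  -- sides; hence `ℓ(S/C) = ℓ(R/S)`.
  rw [eq3]
  rw [eq1] at eq2
  lift Module.length S (S ⧸ C) to ℕ using hCfin with p
  lift Module.length S (C ⧸ A.submoduleOf C) to ℕ using hCAfin with q
  lift Module.length S (R ⧸ (1 : Submodule S R)) to ℕ using hfR with b
  lift Module.length S (S ⧸ A₂) to ℕ using hfA₂ with d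
  norm_cast at *
  omega

omit hxc hE in
/-- If `S` is Gorenstein then the socle of `c / xc` is simple, for the conductor `c`. -/
lemma isSocleCyclic_conductorIdeal [IsLocalRing R] [Module.Finite S R]
    (hE : IsSocleCyclic S (S ⧸ Ideal.span {x})) (hxm : (x : R) ∈ maximalIdeal R) :
    IsSocleCyclic R (conductorIdeal S ⧸ smulRange (x : R) (conductorIdeal S)) := by
  let c := conductorIdeal S
  let A : Ideal S := Ideal.span {x}
  let k := R ⧸ maximalIdeal R
  have hk : Module.length S k ≠ ⊤ := length_ne_top_of_smul_eq_zero hx k fun y => by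
    obtain ⟨y, rfl⟩ := Ideal.Quotient.mk_surjective y
    exact Ideal.Quotient.eq_zero_iff_mem.2 (Ideal.mul_mem_right _ _ hxm)
  have hsm : ∀ u : c, u ∈ smulRange (x : R) c ↔ ∀ r, mulConductor (u : R) u.2 r ∈ A := by
    intro u
    constructor
    · rintro ⟨v, rfl⟩ r
      rw [Ideal.mem_span_singleton']
      refine ⟨⟨v * r, v.2 r⟩, Subtype.ext ?_⟩
      change (v : R) * r * x = x * v * r
      ring
    · intro h
      have h1 := h 1
      rw [Ideal.mem_span_singleton'] at h1
      obtain ⟨s, hs⟩ := h1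
      have hs : (s : R) * x = u * 1 := congrArg Subtype.val hs
      refine ⟨⟨s, fun r => ?_⟩, Subtype.ext ?_⟩
      · obtain ⟨s', hs'⟩ := Ideal.mem_span_singleton'.1 (h r)
        have hs' : (s' : R) * x = u * r := congrArg Subtype.val hs'
        rw [← sub_eq_zero.1 (hxr (s' - s * r) ?_)]
        · exact s'.2
        · have : (s : R) * r * x = s * x * r := by ring
          rw [sub_mul, this, hs, hs']
          ring
      · change (x : R) * s = u
        rw [mul_comm, hs, mul_one]
  -- A socle element `u` of `c/xc` becomes the `S`-linear map `k → S/xS`, `r ↦ u r`; by `hsm` it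
  -- vanishes only if `u ∈ xc`.
  have hΦ : ∀ u : c, (∀ t ∈ maximalIdeal R, t • u ∈ smulRange (x : R) c) →
      ∃ Φ : k →ₗ[S] S ⧸ A, ∀ r : R, Φ (Ideal.Quotient.mk _ r) =
        Submodule.Quotient.mk (mulConductor (u : R) u.2 r) := by
    intro u hu
    refine ⟨((maximalIdeal R).restrictScalars S).liftQ (A.mkQ ∘ₗ mulConductor (u : R) u.2) ?_ ∘ₗ
      (Submodule.Quotient.restrictScalarsEquiv S (maximalIdeal R)).symm.toLinearMap,
      fun r => rfl⟩
    intro t ht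
    rw [LinearMap.mem_ker, LinearMap.comp_apply, Submodule.mkQ_apply, Submodule.Quotient.mk_eq_zero]
    have h := (hsm _).1 (hu t ht) 1
    have : mulConductor ((t • u : c) : R) (t • u).2 1 = mulConductor (u : R) u.2 t :=
      Subtype.ext (by
        change t * (u : R) * 1 = u * t
        ring)
    rwa [this] at h
  intro u v hu0 hu hv
  obtain ⟨u, rfl⟩ := Submodule.Quotient.mk_surjective _ u
  obtain ⟨v, rfl⟩ := Submodule.Quotient.mk_surjective _ v
  simp only [← Submodule.Quotient.mk_smul, Submodule.Quotient.mk_eq_zero, ne_eq] at hu0 hu hv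
  obtain ⟨Φ, hΦu⟩ := hΦ u hu
  obtain ⟨Φ', hΦv⟩ := hΦ v hv
  -- `Ψ` is injective because `k` is a field and `Φ ≠ 0`, and `ℓ_S(Hom_S(k, S/xS)) ≤ ℓ_S(k)` makes
  -- it surjective. So `Φ' = Φ(s ·)`, i.e. `v ≡ s u` modulo `xc`.
  let Ψ : k →ₗ[S] (k →ₗ[S] S ⧸ A) := (LinearMap.mul S k).compr₂ Φ
  have hΨ : ∀ a b, Ψ a b = Φ (a * b) := fun _ _ => rfl
  have hinj : Function.Injective Ψ := by
    rw [injective_iff_map_eq_zero]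
    intro a ha
    obtain ⟨a, rfl⟩ := Ideal.Quotient.mk_surjective a
    by_contra ha0
    have hau : IsUnit a := by
      by_contra h
      exact ha0 (Ideal.Quotient.eq_zero_iff_mem.2 h)
    obtain ⟨b, hb⟩ := hau.exists_right_inv
    refine hu0 ((hsm u).2 fun r => ?_)
    have := LinearMap.congr_fun ha (Ideal.Quotient.mk _ (b * r))
    rwa [hΨ, ← map_mul, ← mul_assoc, hb, one_mul, hΦu, LinearMap.zero_apply,
      Submodule.Quotient.mk_eq_zero] at this
  have hsurj := surjective_of_injective_of_length_le Ψ hinj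
    (length_hom_le hE (Module.length_ne_top_iff.1 hk)) hk
  obtain ⟨s, hs⟩ := hsurj Φ'
  obtain ⟨s, rfl⟩ := Ideal.Quotient.mk_surjective s
  refine ⟨s, ?_⟩
  rw [← Submodule.Quotient.mk_smul, Submodule.Quotient.eq, hsm]
  intro r
  have := LinearMap.congr_fun hs (Ideal.Quotient.mk _ r)
  rw [hΨ, ← map_mul, hΦu, hΦv, Submodule.Quotient.eq] at this
  have h2 : mulConductor ((s • u - v : c) : R) (s • u - v).2 r =
      mulConductor (u : R) u.2 (s * r) - mulConductor (v : R) v.2 r := Subtype.ext (by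
    change (s * (u : R) - v) * r = u * (s * r) - v * r
    ring)
  rwa [h2]

end Conductor

/-! ### Regular elements, the extension `S ⊆ R`, and passage to `Q(R)`. -/

section Extension

variable {R : Type u} [CommRing R]

lemma IsMaximalCohenMacaulay.exists_regular [IsLocalRing R] (hdim : ringKrullDim R = 1)
    {M : Type u} [AddCommGroup M] [Module R M] (h : IsMaximalCohenMacaulay R M) :
    Nontrivial M ∧ ∃ y ∈ maximalIdeal R, ∀ w : M, y • w = 0 → w = 0 := by
  obtain ⟨-, rs, hrs, hreg, hlen⟩ := h
  have hl : rs.length = 1 := by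
    rw [hdim] at hlen
    exact_mod_cast hlen.symm
  obtain ⟨y, rfl⟩ := List.length_eq_one_iff.1 hl
  have := hreg.toIsWeaklyRegular
  rw [RingTheory.Sequence.isWeaklyRegular_singleton_iff] at this
  exact ⟨hreg.nontrivial, y, hrs y (by simp), fun w hw => this.right_eq_zero_of_smul hw⟩

lemma eq_maximalIdeal_of_mem_of_ringKrullDim_eq_one [IsLocalRing R] (hdim : ringKrullDim R = 1)
    {x : R} (hxr : ∀ t, t * x = 0 → t = 0) (P : Ideal R) (hP : P.IsPrime) (hxP : x ∈ P) :
    P = maximalIdeal R := by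
  have hx : x ∈ R⁰ := mem_nonZeroDivisors_iff_right.2 hxr
  have h1 : Ring.KrullDimLE 1 R := (Order.krullDimLE_iff 1 _).2 hdim.le
  rcases Ring.krullDimLE_one_iff.1 h1 P hP with h | h
  · exact absurd hx (Set.disjoint_left.1 (Ideal.disjoint_nonZeroDivisors_of_mem_minimalPrimes h)
      hxP)
  · exact eq_maximalIdeal h

-- The product of denominators of finitely many `S`-module generators of `R` is a common
-- denominator; regular elements of `S` stay regular in `R` because they are units in `Q(R)`.
open Classical in
lemma IsBirationalExtension.exists_mem_conductorIdeal {S : Subring R}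
    (h : IsBirationalExtension S) :
    ∃ a : R, a ∈ conductorIdeal S ∧ ∀ t : R, t * a = 0 → t = 0 := by
  obtain ⟨h1, h2⟩ := h
  have hinj := IsFractionRing.injective R (FractionRing R)
  have hreg : ∀ s : S, s ∈ S⁰ → ∀ t : R, t * s = 0 → t = 0 := by
    intro s hs t ht
    apply hinj
    have hu := IsLocalization.map_units (FractionRing R) (⟨s, hs⟩ : S⁰)
    rw [map_zero]
    apply hu.mul_left_injective
    change algebraMap R _ t * algebraMap R _ s = 0 * _
    rw [← map_mul, ht, map_zero, zero_mul]
  have hden : ∀ r : R, ∃ s ∈ S⁰, (s : R) * r ∈ S := by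
    intro r
    obtain ⟨⟨a, s⟩, has⟩ := IsLocalization.surj S⁰ (algebraMap R (FractionRing R) r)
    refine ⟨s, s.2, ?_⟩
    have : r * (s : S) = (a : R) := hinj (by rw [map_mul]; exact has)
    rw [mul_comm, this]
    exact a.2
  choose d hd hdS using hden
  obtain ⟨G, hG⟩ := h2.fg_top
  let a : S := ∏ g ∈ G, d g
  have ha : a ∈ S⁰ := prod_mem fun g _ => hd g
  refine ⟨a, ?_, hreg a ha⟩
  intro r
  have hr : r ∈ Submodule.span S (G : Set R) := hG ▸ Submodule.mem_top
  induction hr using Submodule.span_induction with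
  | mem g hg =>
    have : a = (∏ g ∈ G.erase g, d g) * d g := (Finset.prod_erase_mul G d hg).symm
    rw [this, S.coe_mul, mul_assoc]
    exact S.mul_mem (SetLike.coe_mem _) (hdS g)
  | zero => rw [mul_zero]; exact S.zero_mem
  | add u v _ _ hu hv => rw [mul_add]; exact S.add_mem hu hv
  | smul s u _ hu =>
    have : (a : R) * (s • u) = s * (a * u) := by
      change (a : R) * ((s : R) * u) = s * (a * u)
      ring
    rw [this]
    exact S.mul_mem s.2 hu

lemma isLocalHom_subtype_of_finite (S : Subring R) [Module.Finite S R] :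
    IsLocalHom S.subtype := by
  have : FaithfulSMul S R := (faithfulSMul_iff_algebraMap_injective S R).2 Subtype.val_injective
  exact (inferInstance : IsLocalHom (algebraMap S R))

/-- By lying over, a prime of `S` containing `x` is contracted from a prime of `R` containing `x`,
which can only be the maximal ideal. -/
lemma eq_maximalIdeal_of_mem_of_finite [IsLocalRing R] (S : Subring R) [IsLocalRing S]
    [Module.Finite S R] {x : S} (hx : ∀ P : Ideal R, P.IsPrime → (x : R) ∈ P → P = maximalIdeal R)
    (P : Ideal S) (hP : P.IsPrime) (hxP : x ∈ P) : P = maximalIdeal S := by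
  have key : ∀ P : Ideal S, P.IsPrime → x ∈ P → P = (maximalIdeal R).comap (algebraMap S R) := by
    intro P hP hxP
    obtain ⟨Q, -, hQ, rfl⟩ := Ideal.exists_ideal_over_prime_of_isIntegral (S := R) P ⊥ (by
      rw [← RingHom.ker_eq_comap_bot, (RingHom.injective_iff_ker_eq_bot _).1 Subtype.val_injective]
      exact bot_le)
    rw [hx Q hQ hxP]
  rw [key P hP hxP, ← key _ inferInstance (le_maximalIdeal hP.ne_top hxP)]

lemma colonSR_eq (S : Subring R) : colonSR S = imageInQ S (conductorIdeal S) := by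
  have hinj := IsFractionRing.injective R (FractionRing R)
  have h1 : ∀ q : FractionRing R, q ∈ (1 : Submodule S (FractionRing R)) ↔
      ∃ s ∈ S, algebraMap R _ s = q := by
    intro q
    rw [Submodule.mem_one]
    exact ⟨fun ⟨s, hs⟩ => ⟨s, s.2, hs⟩, fun ⟨s, hs, h⟩ => ⟨⟨s, hs⟩, h⟩⟩
  ext q
  rw [colonSR, Submodule.mem_div_iff_forall_mul_mem]
  constructor
  · intro h
    obtain ⟨s, hs, hsq⟩ := (h1 _).1 (h 1 ⟨1, Submodule.mem_top, map_one (algebraMap R _)⟩)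
    rw [mul_one] at hsq
    subst hsq
    refine ⟨s, fun r => ?_, rfl⟩
    obtain ⟨s', hs', h'⟩ := (h1 _).1 (h (algebraMap R _ r) ⟨r, Submodule.mem_top, rfl⟩)
    rw [← map_mul] at h'
    rwa [← hinj h']
  · rintro ⟨c, hc, rfl⟩ _ ⟨r, -, rfl⟩
    exact (h1 _).2 ⟨c * r, hc r, map_mul _ _ _⟩

lemma length_imageInQ_quotient (S : Subring R) {I J : Ideal R} (hIJ : I ≤ J) :
    Module.length S (imageInQ S J ⧸ (imageInQ S I).submoduleOf (imageInQ S J)) =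
      Module.length S (J.restrictScalars S ⧸
        (I.restrictScalars S).submoduleOf (J.restrictScalars S)) := by
  have hinj := IsFractionRing.injective R (FractionRing R)
  let j : R →ₗ[S] FractionRing R := (Algebra.linearMap R (FractionRing R)).restrictScalars S
  let e : J.restrictScalars S ≃ₗ[S] imageInQ S J :=
    Submodule.equivMapOfInjective j hinj (J.restrictScalars S)
  refine (Submodule.Quotient.equiv _ _ e ?_).length_eq.symm
  ext ⟨q, hq⟩
  constructor
  · rintro ⟨⟨r, hr⟩, hrI, h⟩
    exact ⟨r, hrI, congrArg Subtype.val h⟩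
  · rintro ⟨r, hr, h⟩
    exact ⟨⟨r, hIJ hr⟩, hr, Subtype.ext h⟩

end Extension

/-! ### The main theorem. -/

theorem proposition3p2 {R : Type u} [CommRing R] [IsLocalRing R]
    (hR : IsCohenMacaulayLocalRing R) (hdim : ringKrullDim R = 1)
    (hnG : ¬ IsGorensteinRing R)
    (ω : Type u) [AddCommGroup ω] [Module R ω] (hω : IsCanonicalModule R ω)
    (S : Subring R) (hS : IsGorensteinRing S) (hSR : IsBirationalExtension S) :
    colonSR S ≤ imageInQ S (traceIdeal R ω) ∧
    ∃ a b c : ℕ,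
      Module.length S (R ⧸ traceIdeal R ω) = (a : ℕ∞) ∧
      Module.length S (R ⧸ (1 : Submodule S R)) = (b : ℕ∞) ∧
      Module.length S (imageInQ S (traceIdeal R ω) ⧸
        (colonSR S).submoduleOf (imageInQ S (traceIdeal R ω))) = (c : ℕ∞) ∧
      (a : ℤ) = 2 * (b : ℤ) - (c : ℤ) := by
  have := hR.1
  have := hS.1
  have := hSR.2
  have : Module.Finite R ω := hω.maximalCohenMacaulay.1
  have := isLocalHom_subtype_of_finite S
  have : IsLocalRing S := RingHom.domain_isLocalRing S.subtype
  obtain ⟨-, y, hym, hyr⟩ := hR.2.exists_regular hdim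
  obtain ⟨_, z, hzm, hzω⟩ := hω.maximalCohenMacaulay.exists_regular hdim
  obtain ⟨a, hac, har⟩ := hSR.exists_mem_conductorIdeal
  -- The factor `a` puts `x` in the conductor, the factor `y` in the maximal ideal; both are
  -- regular.
  let x : S := ⟨a * y, hac y⟩
  have hxc : (x : R) ∈ conductorIdeal S := Ideal.mul_mem_right _ _ hac
  have hxm : (x : R) ∈ maximalIdeal R := Ideal.mul_mem_left _ _ hym
  have hxr : ∀ t : R, t * x = 0 → t = 0 := fun t ht =>
    har t (hyr _ (by rw [smul_eq_mul, mul_comm, mul_assoc]; exact ht))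
  have hxR := eq_maximalIdeal_of_mem_of_ringKrullDim_eq_one hdim hxr
  have hxS := eq_maximalIdeal_of_mem_of_finite S hxR
  have hxSm : x ∈ maximalIdeal S := fun h => hxm (h.map S.subtype)
  have hSE := isSocleCyclic_quotient_of_isGorensteinRing hxS
    (fun t ht => Subtype.ext (hxr t (congrArg Subtype.val ht))) hxSm hS
  -- The given `ω`-regular element is `z`, not `x`; but an element killed by `x` would have a
  -- nonzero socle multiple, killed by `z`.
  have hxω : ∀ w : ω, (x : R) • w = 0 → w = 0 := by
    intro w hw
    by_contra hw0
    obtain ⟨r, hr0, hr⟩ := exists_smul_mem_socle hxR hw0 hw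
    exact hr0 (hzω _ ((hr z).2 hzm))
  have hext : Module.length R (Abelian.Ext (ModuleCat.of R (ResidueField R))
      (ModuleCat.of R ω) 1) = 1 := by
    obtain ⟨d, hd, h⟩ := hω.type_eq_one
    have hd1 : d = 1 := by
      rw [hdim] at hd
      exact_mod_cast hd.symm
    rwa [hd1] at h
  have hωE := isSocleCyclic_quotient_of_length_ext hxm hxω (fun _ => mem_smulRange) hext
  obtain ⟨e⟩ := nonempty_linearEquiv_of_isSocleCyclic hxR hxr hxm hω.finiteInjectiveDimension
    hxω hωE hxc (isSocleCyclic_conductorIdeal hxS hxr hSE hxm)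
  have hle : conductorIdeal S ≤ traceIdeal R ω := le_traceIdeal_of_linearEquiv e
  obtain ⟨hb, hlen⟩ := length_quotient_conductorIdeal hxc hxS hxr hSE
  rw [colonSR_eq, length_imageInQ_quotient S hle,
    ← (Submodule.Quotient.restrictScalarsEquiv S (traceIdeal R ω)).length_eq]
  refine ⟨Submodule.map_mono hle, ?_⟩
  rw [length_quotient_eq_add (show (conductorIdeal S).restrictScalars S ≤
    (traceIdeal R ω).restrictScalars S from hle)] at hlen
  lift Module.length S (R ⧸ (1 : Submodule S R)) to ℕ using hb with b
  have hfin : (2 * b : ℕ∞) ≠ ⊤ := by exact_mod_cast ENat.natCast_ne_top (2 * b)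
  have h1 := ne_top_of_le_ne_top hfin (le_self_add.trans hlen.le)
  have h2 := ne_top_of_le_ne_top hfin (le_add_self.trans hlen.le)
  lift Module.length S ((traceIdeal R ω).restrictScalars S ⧸
    ((conductorIdeal S).restrictScalars S).submoduleOf ((traceIdeal R ω).restrictScalars S))
    to ℕ using h1 with c
  lift Module.length S (R ⧸ (traceIdeal R ω).restrictScalars S) to ℕ using h2 with a
  refine ⟨a, b, c, rfl, rfl, rfl, ?_⟩
  norm_cast at hlen
  omega
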